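/- Let $G$ be a finite undirected multigraph (loops, parallel edges and several components allowed) with vertex set $V$ and edge set $E$, let each edge $e$ be given a head $h(e)$ and a tail $t(e)$, let $K$ be a field, and let $\partial : R^E \to R^V$, $\partial e = h(e) - t(e)$, be the boundary map over $R=\mathbb{Z}$ or $R=K$; put $H_1(G,\mathbb{Z}) = \ker(\partial : \mathbb{Z}^E\to\mathbb{Z}^V)$. A spanning forest of $G$ is a set of edges forming a forest whose components are spanning trees of the components of $G$; a quasi-spanning forest is a spanning forest with one edge removed (all vertices are kept); a cut set is the complement in $E$ of a quasi-spanning forest. Let $p \in K^V$ be a nonzero momentum, i.e. $p \ne 0$ and $\sum_{v\in V(G_\alpha)} p_v = 0$ for every connected component $G_\alpha$ of $G$. A quasi-spanning forest $F$ has exactly two components $T_1,T_2$ that do not span a component of $G$, and with $m_T(p)=\sum_{v\in T}p_v$ one has $m_{T_1}(p)^2=m_{T_2}(p)^2$; this common value is the momentum $s_F(p)=s_C(p)$ of $F$ and of the cut set $C=E\setminus F$. The second graph (Symanzik) polynomial is $$\Phi_G(p,A)=\sum_{F} s_F(p)\prod_{e\notin F}A_e=\sum_{C}s_C(p)\prod_{e\in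 C}A_e \in K[A_e : e\in E],$$ the sums being over the quasi-spanning forests $F$, respectively the cut sets $C$, of $G$. For a nonzero subspace $W\subseteq K^E$ with basis $b=(b_1,\dots,b_\ell)$, the configuration determinant for $b$ is $\det\big(\sum_{e\in E}A_e\,(b_i)_e(b_j)_e\big)_{i,j}$; a configuration polynomial of $W$ is a generator of the principal ideal of $K[A_e : e\in E]$ generated by the configuration determinants in the bases of $W$; and for $I\subseteq E$ with $|I|=\ell$ the Plücker coordinate of $W$ at $I$ in the basis $b$ is the minor $\det\big((b_i)_e\big)_{i,\,e\in I}$, defined up to sign. Let $H_1(G,p)=\partial^{-1}(Kp)\subseteq K^E$. Then $\Phi_G(p,A)$ is a configuration polynomial of $H_1(G,p)$. Moreover, $H_1(G,\mathbb{Z})$ has a finite basis and there is $q\in K^E$ with $\partial q=p$; and for every basis $\ell_1,\dots,\ell_n$ of $H_1(G,\mathbb{Z})$ and every $q\in K^E$ with $\partial q=p$, the vectors $q,\ell_1,\dots,\ell_n$ (the $\ell_i$ being mapped to $K^E$) form a basis of $H_1(G,p)$ for which the configuration determinant equals $\Phi_G(p,A)$. In this basis, every cut set $C$ has $n+1$ elements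 and the square of the Plücker coordinate at $C$ is $s_C(p)$, and the Plücker coordinate at every $(n+1)$-element subset of $E$ that is not a cut set is $0$. -/

import Mathlib

open scoped Graph

namespace GraphPoly

/-! ### Configurations -/

section Configuration

variable {K E ι : Type*} [Field K] [Fintype E] [Fintype ι] [DecidableEq ι]
  {W : Submodule K (E → K)}

/-- The matrix, in the basis `b` of the configuration `W ⊆ K^E`, of the restriction to `W` of the
generic diagonal form `B_E = ∑ e, A_e X_e²`; its entries are linear forms in the variables `A_e`. -/
noncomputable def configMatrix (b : Module.Basis ι K W) : Matrix ι ι (MvPolynomial E K) :=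
  Matrix.of fun i j =>
    ∑ e : E, MvPolynomial.X e * MvPolynomial.C ((b i : E → K) e * (b j : E → K) e)

/-- The configuration determinant for the basis `b`. -/
noncomputable def configDet (b : Module.Basis ι K W) : MvPolynomial E K :=
  (configMatrix b).det

/-- The ideal `det B_E|_W`, generated by the configuration determinants in the bases of `W`
(any one of them generates it, since two of them differ by a nonzero constant). -/
noncomputable def configIdeal (W : Submodule K (E → K)) : Ideal (MvPolynomial E K) :=
  Ideal.span {d | ∃ b : Module.Basis (Fin (Module.finrank K W)) K W, d = configDet b}

/-- `Ψ` is a configuration polynomial of the nonzero configuration `W`: a generator of the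
principal ideal `det B_E|_W`. -/
def IsConfigPolynomial (W : Submodule K (E → K)) (Ψ : MvPolynomial E K) : Prop :=
  W ≠ ⊥ ∧ Ideal.span {Ψ} = configIdeal W

/-- The Plücker coordinate of `W` at `I ⊆ E` in the basis `b`: the determinant of the projection
`W → K^I`, the elements of `I` being listed by `σ`. Another listing changes at most the sign. -/
noncomputable def plucker (b : Module.Basis ι K W) {I : Finset E} (σ : ι ≃ I) : K :=
  (Matrix.of fun i j => (b i : E → K) (σ j : E)).det

end Configuration

/-! ### Multigraphs -/

section Graph

variable {α β : Type*}

/-- `x` and `y` are joined by a path of `H`. -/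
def Joined (H : Graph α β) (x y : α) : Prop := Relation.ReflTransGen H.Adj x y

/-- `H` has no cycle. A cycle of length `n + 1` has distinct vertices `v 0, …, v n` and distinct
edges, the edge `e i` joining `v i` to `v (i + 1)` with indices modulo `n + 1`; a loop is a cycle of
length one and two parallel edges form a cycle of length two. -/
def IsForest (H : Graph α β) : Prop :=
  ¬ ∃ (n : ℕ) (v : Fin (n + 1) → α) (e : Fin (n + 1) → β), Function.Injective v ∧
    Function.Injective e ∧ ∀ i, H.IsLink (e i) (v i) (v (i + 1))

/-- The subgraph of `G` with all the vertices of `G` and with edge set `F`. -/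
def edgeSubgraph (G : Graph α β) (F : Finset E(G)) : Graph α β :=
  G.restrict (Subtype.val '' (F : Set E(G)))

/-- `F` is a forest whose components are spanning trees for the components of `G`. -/
def IsSpanningForest (G : Graph α β) (F : Finset E(G)) : Prop :=
  IsForest (edgeSubgraph G F) ∧ ∀ x y : V(G), Joined (edgeSubgraph G F) x y ↔ Joined G x y

open Classical in
/-- A spanning forest with one edge removed. -/
def IsQuasiSpanningForest (G : Graph α β) (F : Finset E(G)) : Prop :=
  ∃ T : Finset E(G), IsSpanningForest G T ∧ ∃ e ∈ T, F = T.erase e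

open Classical in
/-- The complement of a quasi-spanning forest. -/
def IsCutSet (G : Graph α β) [Fintype E(G)] (C : Finset E(G)) : Prop :=
  ∃ F : Finset E(G), IsQuasiSpanningForest G F ∧ C = Fᶜ

/-- The vertex set of the component of `v` in `H`, where `H` is a subgraph of `G` containing all
the vertices of `G`. -/
def component (G H : Graph α β) (v : V(G)) : Set V(G) := {w | Joined H v w}

variable {K : Type*} [Field K]

open Classical in
/-- `m_T(p) = ∑ v ∈ T, p v`. -/
noncomputable def momentumSum (G : Graph α β) [Fintype V(G)] (T : Set V(G)) (p : V(G) → K) : K :=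
  ∑ v : V(G) with v ∈ T, p v

/-- `p` sums to zero over each connected component of `G`. -/
def IsMomentum (G : Graph α β) [Fintype V(G)] (p : V(G) → K) : Prop :=
  ∀ v : V(G), momentumSum G (component G G v) p = 0

/-- The (vertex sets of the) components of the subgraph with edge set `F` that do not span a
component of `G`. -/
def splitComponents (G : Graph α β) (F : Finset E(G)) : Set (Set V(G)) :=
  {T | ∃ v : V(G), T = component G (edgeSubgraph G F) v ∧ T ≠ component G G v}

open Classical in
/-- The momentum `s_F(p) = m_T(p)²` associated to the quasi-spanning forest `F`, where `T` is one of
the two components of `F` that do not span a component of `G`. If `p` is a momentum, the two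
choices of `T` give the same value. The default value is not used for quasi-spanning forests. -/
noncomputable def forestMomentum (G : Graph α β) [Fintype V(G)] (F : Finset E(G))
    (p : V(G) → K) : K :=
  if h : (splitComponents G F).Nonempty then (momentumSum G h.some p) ^ 2 else 0

open Classical in
/-- The momentum `s_C(p)` associated to the cut set `C`. -/
noncomputable def cutMomentum (G : Graph α β) [Fintype V(G)] [Fintype E(G)] (C : Finset E(G))
    (p : V(G) → K) : K :=
  forestMomentum G Cᶜ p

open Classical in
/-- The second graph polynomial (second Symanzik polynomial)
`Φ_G(p, A) = ∑ s_F(p) ∏ e ∉ F, A_e`, the sum being over the quasi-spanning forests `F` of `G`. -/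
noncomputable def secondGraphPoly (G : Graph α β) [Fintype V(G)] [Fintype E(G)]
    (p : V(G) → K) : MvPolynomial E(G) K :=
  ∑ F : Finset E(G) with IsQuasiSpanningForest G F,
    MvPolynomial.C (forestMomentum G F p) * ∏ e ∈ Fᶜ, MvPolynomial.X e

/-- An orientation of `G`: a choice of head and tail for each edge. -/
structure EdgeOrientation (G : Graph α β) where
  head : E(G) → V(G)
  tail : E(G) → V(G)
  isLink : ∀ e : E(G), G.IsLink e (head e) (tail e)

open Classical in
/-- The boundary map `R^E → R^V`, `∂ e = head e - tail e`. -/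
noncomputable def boundary {G : Graph α β} [Fintype E(G)] (o : EdgeOrientation G)
    (R : Type*) [CommRing R] : (E(G) → R) →ₗ[R] (V(G) → R) :=
  Fintype.linearCombination R fun e => Pi.single (o.head e) 1 - Pi.single (o.tail e) 1

/-- The first homology `H_1(G, ℤ) = ker ∂`. -/
noncomputable def integralHomology {G : Graph α β} [Fintype E(G)] (o : EdgeOrientation G) :
    Submodule ℤ (E(G) → ℤ) :=
  LinearMap.ker (boundary o ℤ)

/-- The homology of `G` relative to `p`, `H_1(G, p) = ∂⁻¹(K p) ⊆ K^E`. -/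
noncomputable def relativeHomology {G : Graph α β} [Fintype E(G)] (o : EdgeOrientation G)
    (p : V(G) → K) : Submodule K (E(G) → K) :=
  (Submodule.span K {p}).comap (boundary o K)

end Graph

end GraphPoly

open GraphPoly

/-! By Cauchy–Binet, a configuration determinant is the sum over edge sets `I` of the squared minor
at `I` times the monomial of `I` (`configDet_eq_sum`). It remains to compute the squared minors of
the basis `q, ℓ₁, …, ℓₙ`, according to the complement `F` of `I`.

If `F` contains a cycle, that cycle is a nonzero vector of the configuration vanishing on `I`, so
the minor is zero. If `F` is a forest, it lies in a spanning forest `T`. Since `n` edges lie outside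
`T` and `I` has `n + 1`, `F` is `T` minus one edge and `I` is a cut set
(`plucker_eq_zero_of_not_isCutSet`).

For a cut set `I = (E \ T) ∪ {e}`, adding a combination of the `ℓᵢ` to `q` gives a chain `q'`
carried by `T` with the same boundary `p`. The row of `q'` is `(q'_e, 0, …, 0)`, and the remaining
block is the minor of the integral basis at `E \ T`. That minor is `±1` because `H_1(G, ℤ) → ℤ^(E \
T)` is an isomorphism (`IsSpanningForest.homologyEquiv`). As `e` is the only edge of `T` leaving its
head side in `T - e`, `q'_e` is the sum of `p` over that side, and its square is the momentum
(`plucker_sq_of_isCutSet`).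

Working over `ℤ` makes the answer exact rather than up to a constant, in every characteristic. -/

namespace GraphPoly

/-! ### Cauchy–Binet for diagonal forms -/

section Determinants

open Matrix Finset

variable {R ι E : Type*} [CommRing R] [Fintype ι] [DecidableEq ι]

/-- Listing the columns of a square matrix in another order changes its determinant at most by a
sign. -/
theorem det_submatrix_sq_eq {κ : Type*} (B : Matrix ι κ R) (σ τ : ι ≃ κ) :
    (B.submatrix id σ).det ^ 2 = (B.submatrix id τ).det ^ 2 := by
  have h : B.submatrix id σ = (B.submatrix id τ).submatrix id (σ.trans τ.symm) := by
    ext i j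
    simp
  rw [h, det_permute', mul_pow]
  rcases Int.units_eq_one_or (Equiv.Perm.sign (σ.trans τ.symm)) with h | h <;> simp [h]

/-- Multilinear expansion of the Gram determinant of a diagonal form. -/
theorem det_diagonalForm_expand [Fintype E] (B : Matrix ι E R) (a : E → R) :
    (Matrix.of fun i j => ∑ e, a e * (B i e * B j e)).det =
      ∑ f : ι → E, (∏ i, a (f i)) * (∏ i, B i (f i)) * (B.submatrix id f).det := by
  classical
  have h : (Matrix.of fun i j => ∑ e, a e * (B i e * B j e)) =
      fun i => ∑ e, (a e * B i e) • (fun j => B j e) := by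
    ext i j
    simp [mul_assoc]
  have h2 := (detRowAlternating : (ι → R) [⋀^ι]→ₗ[R] R).toMultilinearMap.map_sum
    (fun i (e : E) => (a e * B i e) • (fun j => B j e))
  have h3 : (Matrix.of fun i j => ∑ e, a e * (B i e * B j e)).det =
      (detRowAlternating : (ι → R) [⋀^ι]→ₗ[R] R).toMultilinearMap
        (fun i => ∑ e, (a e * B i e) • (fun j => B j e)) := by rw [h]; rfl
  rw [h3, h2]
  refine Finset.sum_congr rfl fun f _ => ?_
  rw [MultilinearMap.map_smul_univ, Finset.prod_mul_distrib, smul_eq_mul, ← det_transpose]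
  rfl

/-- Permuting columns multiplies the determinant by the sign, so the sum is `M.det` times its own
Leibniz expansion. In Cauchy–Binet it collects all listings of one column set. -/
theorem sum_perm_prod_mul_det (M : Matrix ι ι R) :
    ∑ π : Equiv.Perm ι, (∏ i, M i (π i)) * (M.submatrix id π).det = M.det ^ 2 := by
  have h : M.det = ∑ π : Equiv.Perm ι, (Equiv.Perm.sign π : R) * ∏ i, M i (π i) := by
    rw [← det_transpose, det_apply']
    rfl
  rw [sq]
  nth_rewrite 2 [h]
  rw [Finset.mul_sum]
  refine Finset.sum_congr rfl fun π _ => ?_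
  rw [det_permute']
  ring

/-- The Cauchy–Binet formula for the Gram determinant of a diagonal form, `D I` being the square of
the maximal minor with columns `I`. -/
theorem det_diagonalForm [Fintype E] (B : Matrix ι E R) (a : E → R) (D : Finset E → R)
    (hD : ∀ (I : Finset E) (σ : ι ≃ I), (B.submatrix id fun j => (σ j : E)).det ^ 2 = D I)
    (hD0 : ∀ I : Finset E, IsEmpty (ι ≃ I) → D I = 0) :
    (Matrix.of fun i j => ∑ e, a e * (B i e * B j e)).det =
      ∑ I : Finset E, D I * ∏ e ∈ I, a e := by
  classical
  -- Group the functions by image `I`. Non-injective ones contribute zero because of a repeated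
  -- column; the injective ones are `σ ∘ π` for a fixed listing `σ` and a permutation `π`.
  rw [det_diagonalForm_expand, ← Finset.sum_fiberwise _ (fun f : ι → E => univ.image f)]
  refine Finset.sum_congr rfl fun I _ => ?_
  have hinj : ∀ f : ι → E, ¬ Function.Injective f → (B.submatrix id f).det = 0 := by
    intro f hf
    simp only [Function.Injective, not_forall] at hf
    obtain ⟨i, j, hij, hne⟩ := hf
    exact det_zero_of_column_eq hne fun k => by simp [hij]
  rcases isEmpty_or_nonempty (ι ≃ I) with hI | ⟨⟨σ⟩⟩
  · rw [hD0 I hI, zero_mul]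
    refine Finset.sum_eq_zero fun f hf => ?_
    rw [hinj f, mul_zero]
    intro hf'
    have hfI : univ.image f = I := by simpa using hf
    have hcard : Fintype.card ι = Fintype.card I := by
      rw [Fintype.card_coe, ← hfI, Finset.card_image_of_injective _ hf', Finset.card_univ]
    exact hI.false (Fintype.equivOfCardEq hcard)
  · rw [← hD I σ, ← sum_perm_prod_mul_det, Finset.sum_mul]
    symm
    refine Finset.sum_of_injOn (fun π i => (σ (π i) : E)) ?_ ?_ ?_ ?_
    · intro π _ π' _ h
      ext i
      have := congrFun h i
      exact σ.injective (Subtype.ext this)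
    · intro π _
      simp only [coe_filter, mem_univ, true_and, Set.mem_ofPred_eq]
      ext e
      simp only [mem_image, mem_univ, true_and]
      constructor
      · rintro ⟨i, rfl⟩
        exact (σ (π i)).2
      · intro he
        exact ⟨π.symm (σ.symm ⟨e, he⟩), by simp⟩
    · intro f hf hf'
      rw [hinj f, mul_zero]
      intro hfi
      apply hf'
      have hfI : univ.image f = I := by simpa using hf
      have hmem : ∀ i, f i ∈ I := fun i => hfI ▸ mem_image_of_mem f (mem_univ i)
      have hg : Function.Injective fun i => σ.symm ⟨f i, hmem i⟩ := by
        intro i j h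
        exact hfi (congrArg Subtype.val (σ.symm.injective h))
      refine ⟨Equiv.ofBijective _ (Finite.injective_iff_bijective.mp hg), by simp, ?_⟩
      ext i
      simp
    · intro π _
      have h : ∏ i, a (σ (π i)) = ∏ e ∈ I, a e := by
        rw [← Finset.prod_coe_sort I, ← (π.trans σ).prod_comp fun e : I => a e]
        rfl
      rw [h, submatrix_submatrix]
      change (∏ i, B i (σ (π i))) * (B.submatrix id fun i => (σ (π i) : E)).det * _ = _
      ring

end Determinants

/-! ### Configuration determinants and Plücker coordinates -/

section Configuration

open Matrix

variable {K E ι : Type*} [Field K] [Fintype ι] [DecidableEq ι]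
  {W : Submodule K (E → K)}

theorem plucker_eq_det_submatrix (b : Module.Basis ι K W) {I : Finset E} (σ : ι ≃ I) :
    plucker b σ =
      ((Matrix.of fun i e => (b i : E → K) e : Matrix ι E K).submatrix id fun j => (σ j : E)).det :=
  rfl

theorem plucker_sq_eq (b : Module.Basis ι K W) {I : Finset E} (σ τ : ι ≃ I) :
    plucker b σ ^ 2 = plucker b τ ^ 2 :=
  det_submatrix_sq_eq (Matrix.of fun i (e : I) => (b i : E → K) e) σ τ

/-- A Plücker coordinate vanishes if some nonzero vector of the configuration has all the
corresponding coordinates equal to zero. -/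
theorem plucker_eq_zero (b : Module.Basis ι K W) {I : Finset E} (σ : ι ≃ I) {w : E → K}
    (hw : w ∈ W) (hw0 : w ≠ 0) (hI : ∀ e ∈ I, w e = 0) : plucker b σ = 0 := by
  -- The coordinates of `w` in the basis are a linear relation between the rows of the minor.
  refine Matrix.exists_vecMul_eq_zero_iff.mp ⟨fun i => b.repr ⟨w, hw⟩ i, ?_, ?_⟩
  · intro h
    apply hw0
    have : b.repr ⟨w, hw⟩ = 0 := Finsupp.ext fun i => congrFun h i
    have := b.repr.map_eq_zero_iff.mp this
    exact congrArg Subtype.val this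
  · ext j
    have h := congrArg Subtype.val (b.sum_repr ⟨w, hw⟩)
    have h2 := congrFun h (σ j)
    simp only [Submodule.coe_sum, Submodule.coe_smul, Finset.sum_apply, Pi.smul_apply,
      smul_eq_mul] at h2
    simp only [vecMul, dotProduct, Matrix.of_apply, Pi.zero_apply]
    rw [h2, hI _ (σ j).2]

variable [Fintype E]

/-- The configuration determinant in terms of the squares of the Plücker coordinates. -/
theorem configDet_eq_sum (b : Module.Basis ι K W) (D : Finset E → K)
    (hD : ∀ (I : Finset E) (σ : ι ≃ I), plucker b σ ^ 2 = D I)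
    (hD0 : ∀ I : Finset E, IsEmpty (ι ≃ I) → D I = 0) :
    configDet b =
      ∑ I : Finset E, MvPolynomial.C (D I) * ∏ e ∈ I, (MvPolynomial.X e : MvPolynomial E K) := by
  have h := det_diagonalForm
    (Matrix.of fun i e => MvPolynomial.C ((b i : E → K) e) : Matrix ι E (MvPolynomial E K))
    (fun e => MvPolynomial.X e) (fun I => MvPolynomial.C (D I)) ?_ ?_
  · rw [← h]
    simp [configDet, configMatrix]
  · intro I σ
    rw [← hD I σ, plucker_eq_det_submatrix, map_pow, RingHom.map_det]
    rfl
  · intro I hI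
    rw [hD0 I hI, map_zero]

/-- Configuration determinants in two bases differ by the square of a nonzero constant. -/
theorem configDet_change (b b' : Module.Basis ι K W) :
    configDet b' = MvPolynomial.C ((b.toMatrix b').det ^ 2) * configDet b := by
  set P : Matrix ι ι (MvPolynomial E K) := (b.toMatrix b').map MvPolynomial.C with hP
  have hPdet : P.det = MvPolynomial.C (b.toMatrix b').det :=
    (RingHom.map_det (MvPolynomial.C : K →+* MvPolynomial E K) _).symm
  have hb : ∀ j e, (b' j : E → K) e = ∑ i, b.toMatrix b' i j * (b i : E → K) e := by
    intro j e
    have h := congrFun (congrArg Subtype.val (b.sum_toMatrix_smul_self b' j)) e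
    rw [← h]
    simp only [Submodule.coe_sum, Submodule.coe_smul, Finset.sum_apply, Pi.smul_apply, smul_eq_mul]
  have h : configMatrix b' = Pᵀ * configMatrix b * P := by
    refine Matrix.ext fun i j => ?_
    simp only [configMatrix, Matrix.of_apply, Matrix.mul_apply, hb, hP, transpose_apply,
      Matrix.map_apply, Finset.sum_mul, Finset.mul_sum, map_sum, map_mul]
    rw [Finset.sum_comm]
    refine Finset.sum_congr rfl fun l _ => ?_
    rw [Finset.sum_comm]
    refine Finset.sum_congr rfl fun k _ => ?_
    refine Finset.sum_congr rfl fun e _ => ?_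
    ring
  rw [configDet, configDet, h, det_mul, det_mul, det_transpose, hPdet, map_pow]
  ring

/-- Needed because `configIdeal` only admits bases indexed by `Fin (finrank K W)`. -/
theorem configDet_reindex {κ : Type*} [Fintype κ] [DecidableEq κ] (b : Module.Basis ι K W)
    (e : ι ≃ κ) : configDet (b.reindex e) = configDet b := by
  have : configMatrix (b.reindex e) = (configMatrix b).submatrix e.symm e.symm := by
    ext1 i j
    simp [configMatrix]
  rw [configDet, this, Matrix.det_submatrix_equiv_self, configDet]

/-- The configuration determinant in any basis is a configuration polynomial. -/
theorem isConfigPolynomial_configDet (b : Module.Basis ι K W) (hW : W ≠ ⊥) :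
    IsConfigPolynomial W (configDet b) := by
  refine ⟨hW, le_antisymm ?_ ?_⟩
  · rw [Ideal.span_singleton_le_iff_mem]
    have e : ι ≃ Fin (Module.finrank K W) :=
      Fintype.equivOfCardEq (by rw [Fintype.card_fin, Module.finrank_eq_card_basis b])
    exact Ideal.subset_span ⟨b.reindex e, (configDet_reindex b e).symm⟩
  · rw [configIdeal, Ideal.span_le]
    rintro _ ⟨b', rfl⟩
    have e : Fin (Module.finrank K W) ≃ ι :=
      Fintype.equivOfCardEq (by rw [Fintype.card_fin, Module.finrank_eq_card_basis b])
    rw [← configDet_reindex b' e, configDet_change b (b'.reindex e)]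
    exact Ideal.mul_mem_left _ _ (Ideal.mem_span_singleton_self _)

end Configuration

/-! ### Paths, forests and edge removal -/

section Connectivity

open Classical

variable {α β : Type*} {G : Graph α β}

theorem Joined.symm {H : Graph α β} {x y : α} (h : Joined H x y) : Joined H y x := by
  induction h with
  | refl => exact Relation.ReflTransGen.refl
  | tail _ hbc ih => exact Relation.ReflTransGen.head hbc.symm ih

theorem Joined.trans {H : Graph α β} {x y z : α} (h : Joined H x y) (h' : Joined H y z) :
    Joined H x z :=
  Relation.ReflTransGen.trans h h'

theorem Joined.of_adj {H H' : Graph α β} (hH : ∀ a b, H.Adj a b → Joined H' a b) {x y : α}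
    (h : Joined H x y) : Joined H' x y := by
  induction h with
  | refl => exact Relation.ReflTransGen.refl
  | tail _ hbc ih => exact ih.trans (hH _ _ hbc)

theorem edgeSubgraph_isLink {F : Finset E(G)} {e : β} {x y : α} :
    (edgeSubgraph G F).IsLink e x y ↔ (∃ h : e ∈ E(G), ⟨e, h⟩ ∈ F) ∧ G.IsLink e x y := by
  simp [edgeSubgraph, Graph.restrict_isLink, and_comm]

theorem edgeSubgraph_adj {F : Finset E(G)} {x y : α} :
    (edgeSubgraph G F).Adj x y ↔ ∃ e ∈ F, G.IsLink (e : β) x y := by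
  constructor
  · rintro ⟨e, he⟩
    obtain ⟨⟨h, hF⟩, hl⟩ := edgeSubgraph_isLink.mp he
    exact ⟨⟨e, h⟩, hF, hl⟩
  · rintro ⟨e, he, hl⟩
    exact ⟨e, edgeSubgraph_isLink.mpr ⟨⟨e.2, he⟩, hl⟩⟩

theorem Joined.of_edgeSubgraph {F : Finset E(G)} {x y : α}
    (hj : Joined (edgeSubgraph G F) x y) : Joined G x y := by
  refine hj.of_adj fun a b hab => Relation.ReflTransGen.single ?_
  obtain ⟨e, he, hl⟩ := edgeSubgraph_adj.mp hab
  exact ⟨e, hl⟩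

theorem joined_of_isLink {F : Finset E(G)} {e : E(G)} (he : e ∈ F) {x y : α}
    (h : G.IsLink (e : β) x y) : Joined (edgeSubgraph G F) x y :=
  Relation.ReflTransGen.single (edgeSubgraph_adj.mpr ⟨e, he, h⟩)

theorem mem_component {H : Graph α β} {v w : V(G)} : w ∈ component G H v ↔ Joined H v w :=
  Iff.rfl

theorem self_mem_component {H : Graph α β} (v : V(G)) : v ∈ component G H v :=
  Relation.ReflTransGen.refl

theorem component_eq_of_joined {H : Graph α β} {v w : V(G)} (h : Joined H v w) :
    component G H v = component G H w :=
  Set.ext fun _ => ⟨fun h' => h.symm.trans h', fun h' => h.trans h'⟩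

/-- A joining path may be taken without repeated vertices. -/
theorem Joined.exists_injective {H : Graph α β} {x y : α} (h : Joined H x y) :
    ∃ (n : ℕ) (v : ℕ → α), v 0 = x ∧ v n = y ∧ (∀ i < n, H.Adj (v i) (v (i + 1))) ∧
      ∀ i ≤ n, ∀ j ≤ n, v i = v j → i = j := by
  -- Dropping loops and multiplicities leaves joinedness unchanged and makes simple-graph paths
  -- available.
  let S : SimpleGraph α := SimpleGraph.fromRel H.Adj
  have hS : ∀ a b, S.Adj a b → H.Adj a b := by
    intro a b hab
    rcases (SimpleGraph.fromRel_adj _ _ _).mp hab with ⟨-, h | h⟩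
    exacts [h, h.symm]
  have hr : S.Reachable x y := by
    induction h with
    | refl => exact SimpleGraph.Reachable.refl x
    | @tail b c _ hbc ih =>
      by_cases hne : b = c
      · exact hne ▸ ih
      · exact ih.trans (SimpleGraph.Adj.reachable
          ((SimpleGraph.fromRel_adj _ _ _).mpr ⟨hne, Or.inl hbc⟩))
  obtain ⟨p, hp⟩ := hr.exists_isPath
  refine ⟨p.length, p.getVert, by simp, by simp, fun i hi => hS _ _ (p.adj_getVert_succ hi), ?_⟩
  intro i hi j hj hij
  exact hp.getVert_injOn hi hj hij

/-- In a forest, the ends of an edge are separated by the removal of the edge. -/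
theorem IsForest.not_joined_erase {T : Finset E(G)} (hT : IsForest (edgeSubgraph G T)) {e : E(G)}
    (he : e ∈ T) {x y : α} (hxy : G.IsLink (e : β) x y) :
    ¬ Joined (edgeSubgraph G (T.erase e)) x y := by
  intro hj
  obtain ⟨n, v, rfl, rfl, hadj, hinj⟩ := hj.exists_injective
  apply hT
  have : Nonempty E(G) := ⟨e⟩
  choose! f hf hl using fun i hi => edgeSubgraph_adj.mp (hadj i hi)
  -- The path closed up by `e`, placed at the last index, is a cycle in `T`. If `e` is a loop, then
  -- `n = 0` and the cycle is `e` alone.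
  refine ⟨n, fun i => v i, fun i => if (i : ℕ) < n then (f i : β) else e, ?_, ?_, ?_⟩
  · intro i j hij
    exact Fin.ext (hinj i (by omega) j (by omega) hij)
  · have key : ∀ i < n, ∀ j < n, (f i : β) = f j → i = j := by
      intro i hi j hj h
      have h1 := hl i hi
      rw [h] at h1
      rcases h1.eq_and_eq_or_eq_and_eq (hl j hj) with ⟨h2, -⟩ | ⟨h2, h3⟩
      · exact hinj i hi.le j hj.le h2
      · have := hinj i hi.le (j + 1) hj h2
        have := hinj (i + 1) hi j hj.le h3
        omega
    have key' : ∀ i < n, (f i : β) ≠ e := by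
      intro i hi h
      exact (Finset.mem_erase.mp (hf i hi)).1 (Subtype.ext h)
    intro i j hij
    dsimp only at hij
    split_ifs at hij with h1 h2 h2
    · exact Fin.ext (key i h1 j h2 hij)
    · exact absurd hij (key' i h1)
    · exact absurd hij.symm (key' j h2)
    · exact Fin.ext (by omega)
  · intro i
    dsimp only
    rw [edgeSubgraph_isLink]
    split_ifs with h
    · have hi : ((i + 1 : Fin (n + 1)) : ℕ) = i + 1 := by
        rw [Fin.val_add_one_of_lt]
        exact Fin.lt_def.mpr (by simpa using h)
      rw [hi]
      exact ⟨⟨(f i).2, (Finset.mem_erase.mp (hf i h)).2⟩, hl i h⟩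
    · have hi : i = Fin.last n := Fin.ext (by simp; omega)
      subst hi
      simp only [Fin.last_add_one, Fin.val_last, Fin.val_zero]
      exact ⟨⟨e.2, he⟩, hxy.symm⟩

/-- A path in `T` either avoids the edge `e` or joins its origin to an end of `e` while avoiding
`e`. -/
theorem Joined.erase_or {T : Finset E(G)} {e : E(G)} {h t : α} (hl : G.IsLink (e : β) h t)
    {x y : α} (hj : Joined (edgeSubgraph G T) x y) :
    Joined (edgeSubgraph G (T.erase e)) x y ∨
      Joined (edgeSubgraph G (T.erase e)) x h ∨ Joined (edgeSubgraph G (T.erase e)) x t := by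
  induction hj with
  | refl => exact Or.inl Relation.ReflTransGen.refl
  | @tail b c _ hbc ih =>
    rcases ih with ih | ih
    · obtain ⟨f, hf, hfl⟩ := edgeSubgraph_adj.mp hbc
      -- At the first use of `e`, the path avoiding `e` has already reached one of its ends.
      by_cases hfe : f = e
      · subst hfe
        rcases hfl.left_eq_or_eq hl with rfl | rfl
        exacts [Or.inr (Or.inl ih), Or.inr (Or.inr ih)]
      · exact Or.inl (ih.trans (joined_of_isLink (Finset.mem_erase.mpr ⟨hfe, hf⟩) hfl))
    · exact Or.inr ih

end Connectivity

/-! ### Chains carried by forests and their boundaries -/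

section Chains

open Classical

variable {α β : Type*} {G : Graph α β} [Fintype E(G)] (o : EdgeOrientation G)
  {R : Type*} [CommRing R]

theorem boundary_single (e : E(G)) (r : R) :
    boundary o R (Pi.single e r) = r • (Pi.single (o.head e) 1 - Pi.single (o.tail e) 1) := by
  simp [boundary]

theorem boundary_apply (w : E(G) → R) :
    boundary o R w = ∑ e, w e • (Pi.single (o.head e) 1 - Pi.single (o.tail e) 1) := by
  simp [boundary, Fintype.linearCombination_apply]

/-- An edge with ends `x` and `y` carries a chain with boundary `y - x`. -/
theorem exists_sign_boundary {e : E(G)} {x y : V(G)} (h : G.IsLink (e : β) x y) :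
    ∃ r : R, IsUnit r ∧ boundary o R (Pi.single e r) = Pi.single y 1 - Pi.single x 1 := by
  rcases h.eq_and_eq_or_eq_and_eq (o.isLink e) with ⟨h1, h2⟩ | ⟨h1, h2⟩
  · refine ⟨-1, isUnit_one.neg, ?_⟩
    rw [boundary_single, Subtype.ext h1, Subtype.ext h2]
    simp
  · refine ⟨1, isUnit_one, ?_⟩
    rw [boundary_single, Subtype.ext h1, Subtype.ext h2]
    simp

-- The signed edges of a path telescope. This turns connectivity in `F` into chains carried by `F`.
variable (R) in
theorem Joined.exists_chain {F : Finset E(G)} {x y : V(G)}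
    (h : Joined (edgeSubgraph G F) x y) :
    ∃ w : E(G) → R, (∀ e ∉ F, w e = 0) ∧ boundary o R w = Pi.single y 1 - Pi.single x 1 := by
  suffices ∀ z : α, Joined (edgeSubgraph G F) x z → ∀ hz : z ∈ V(G), ∃ w : E(G) → R,
      (∀ e ∉ F, w e = 0) ∧ boundary o R w = Pi.single ⟨z, hz⟩ 1 - Pi.single x 1 from
    this y h y.2
  intro z hz
  induction hz with
  | refl => exact fun hz => ⟨0, by simp, by simp⟩
  | @tail b c _ hbc ih =>
    intro hc
    obtain ⟨e, he, hl⟩ := edgeSubgraph_adj.mp hbc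
    obtain ⟨w, hw, hwb⟩ := ih hl.left_mem
    obtain ⟨r, -, hr⟩ := exists_sign_boundary o (R := R) (x := ⟨b, hl.left_mem⟩) (y := ⟨c, hc⟩) hl
    refine ⟨w + Pi.single e r, fun f hf => ?_, ?_⟩
    · have : f ≠ e := fun h => hf (h ▸ he)
      simp [hw f hf, this]
    · rw [map_add, hwb, hr]
      abel

/-- A set of edges that is not a forest carries a nonzero cycle. -/
theorem exists_cycle_of_not_isForest [Nontrivial R] {F : Finset E(G)}
    (hF : ¬ IsForest (edgeSubgraph G F)) :
    ∃ w : E(G) → R, w ≠ 0 ∧ (∀ e ∉ F, w e = 0) ∧ boundary o R w = 0 := by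
  obtain ⟨n, v, e, -, he, hl⟩ := not_not.mp hF
  simp only [edgeSubgraph_isLink] at hl
  choose hm hl using hl
  choose hE hm using hm
  have hr := fun i => exists_sign_boundary o (R := R) (e := ⟨e i, hE i⟩)
    (x := ⟨v i, (hl i).left_mem⟩) (y := ⟨v (i + 1), (hl i).right_mem⟩) (hl i)
  choose r hu hr using hr
  refine ⟨∑ i, Pi.single ⟨e i, hE i⟩ (r i), fun h => ?_, fun f hf => ?_, ?_⟩
  -- The edges of the cycle are distinct, so the coefficient at `e 0` is a single unit.
  · have h0 := congrFun h ⟨e 0, hE 0⟩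
    rw [Finset.sum_apply, Finset.sum_eq_single 0] at h0
    · simp only [Pi.single_eq_same, Pi.zero_apply] at h0
      exact (hu 0).ne_zero h0
    · intro i _ hi
      refine Pi.single_eq_of_ne (fun h => hi ?_) _
      exact (he (congrArg Subtype.val h)).symm
    · simp
  · rw [Finset.sum_apply]
    refine Finset.sum_eq_zero fun i _ => Pi.single_eq_of_ne (fun h => hf ?_) _
    rw [h]
    exact hm i
  · rw [map_sum]
    simp only [hr, Finset.sum_sub_distrib]
    rw [sub_eq_zero]
    -- The boundary cancels because `i ↦ i + 1` permutes the cyclic indices.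
    exact Equiv.sum_comp (Equiv.addRight (1 : Fin (n + 1)))
      (fun i => (Pi.single ⟨v i, (hl i).left_mem⟩ 1 : V(G) → R))

/-- Every chain can be moved to a spanning forest without changing its boundary. -/
theorem IsSpanningForest.exists_chain {T : Finset E(G)} (hT : IsSpanningForest G T)
    (w : E(G) → R) :
    ∃ w' : E(G) → R, (∀ e ∉ T, w' e = 0) ∧ boundary o R w' = boundary o R w := by
  -- Each edge is replaced by a path in `T` from its tail to its head.
  have h : ∀ e : E(G), ∃ u : E(G) → R, (∀ f ∉ T, u f = 0) ∧
      boundary o R u = Pi.single (o.head e) 1 - Pi.single (o.tail e) 1 := by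
    intro e
    refine Joined.exists_chain o R ((hT.2 _ _).mpr ?_)
    exact Relation.ReflTransGen.single ⟨e, (o.isLink e).symm⟩
  choose u hu hub using h
  refine ⟨∑ e, w e • u e, fun f hf => ?_, ?_⟩
  · simp [hu _ f hf]
  · rw [map_sum, boundary_apply]
    simp [hub]

variable [Fintype V(G)]

theorem sum_boundary (w : E(G) → R) (S : Set V(G)) :
    ∑ v with v ∈ S, boundary o R w v =
      ∑ e, w e * ((if o.head e ∈ S then 1 else 0) - if o.tail e ∈ S then 1 else 0) := by
  have h : ∀ u : V(G), ∑ v with v ∈ S, (Pi.single u 1 : V(G) → R) v = if u ∈ S then 1 else 0 := by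
    intro u
    simp [Pi.single_apply]
  rw [boundary_apply]
  simp only [Finset.sum_apply, Pi.smul_apply, Pi.sub_apply, smul_eq_mul]
  rw [Finset.sum_comm]
  simp only [← Finset.mul_sum, Finset.sum_sub_distrib, h]

/-- The boundary of a chain carried by `F` and one more edge, summed over a component of `F`. -/
theorem sum_component_boundary {F : Finset E(G)} {e : E(G)} {w : E(G) → R}
    (hw : ∀ f ∉ F, f ≠ e → w f = 0) (x : V(G)) :
    ∑ v with v ∈ component G (edgeSubgraph G F) x, boundary o R w v =
      w e * ((if o.head e ∈ component G (edgeSubgraph G F) x then 1 else 0) -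
        if o.tail e ∈ component G (edgeSubgraph G F) x then 1 else 0) := by
  rw [sum_boundary]
  refine Finset.sum_eq_single e (fun f _ hf => ?_) (by simp)
  -- An edge of `F` has both ends in the component or neither, so it contributes nothing.
  by_cases hfF : f ∈ F
  · have h := joined_of_isLink hfF (o.isLink f)
    have : o.head f ∈ component G (edgeSubgraph G F) x ↔
        o.tail f ∈ component G (edgeSubgraph G F) x :=
      ⟨fun h' => h'.trans h, fun h' => h'.trans h.symm⟩
    simp [this]
  · simp [hw f hfF hf]

/-- The coefficients of a chain carried by a forest are determined by its boundary. -/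
theorem IsForest.sum_component_boundary {T : Finset E(G)} (hT : IsForest (edgeSubgraph G T))
    {e : E(G)} (he : e ∈ T) {w : E(G) → R} (hw : ∀ f ∉ T, w f = 0) :
    ∑ v with v ∈ component G (edgeSubgraph G (T.erase e)) (o.head e), boundary o R w v = w e := by
  rw [GraphPoly.sum_component_boundary o (e := e), if_pos (self_mem_component _),
    if_neg (mem_component.not.mpr (hT.not_joined_erase he (o.isLink e))), sub_zero, mul_one]
  intro f hf hfe
  exact hw f fun h => hf (Finset.mem_erase.mpr ⟨hfe, h⟩)

/-- Each coefficient is the sum of the boundary over one side of the removed edge. Hence a cycle is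
determined by its coefficients off `T`. -/
theorem IsForest.eq_zero_of_boundary_eq_zero {T : Finset E(G)}
    (hT : IsForest (edgeSubgraph G T)) {w : E(G) → R} (hw : ∀ f ∉ T, w f = 0)
    (hb : boundary o R w = 0) : w = 0 := by
  ext e
  by_cases he : e ∈ T
  · rw [← hT.sum_component_boundary o he hw, hb]
    simp
  · exact hw e he

/-- A forest is contained in a spanning forest. -/
theorem IsForest.exists_isSpanningForest (o : EdgeOrientation G) {F : Finset E(G)}
    (hF : IsForest (edgeSubgraph G F)) : ∃ T, F ⊆ T ∧ IsSpanningForest G T := by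
  -- A maximal forest spans. Otherwise an edge `e` between two components of `T` creates a nonzero
  -- cycle in `T ∪ {e}`; summing its boundary over the component of the head makes its coefficient
  -- at `e` zero, leaving a nonzero cycle in the forest `T`.
  obtain ⟨T, hFT, hT⟩ := Finite.exists_le_maximal
    (p := fun T : Finset E(G) => IsForest (edgeSubgraph G T)) hF
  refine ⟨T, hFT, hT.1, fun x y => ⟨Joined.of_edgeSubgraph, fun h => ?_⟩⟩
  have key : ∀ e : E(G), Joined (edgeSubgraph G T) (o.head e) (o.tail e) := by
    intro e
    by_contra hne
    have heT : e ∉ T := fun h => hne (joined_of_isLink h (o.isLink e))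
    have hnf : ¬ IsForest (edgeSubgraph G (insert e T)) := fun h =>
      heT (hT.2 h (Finset.subset_insert e T) (Finset.mem_insert_self e T))
    obtain ⟨w, hw0, hw, hwb⟩ := exists_cycle_of_not_isForest o (R := ℤ) hnf
    have h1 := GraphPoly.sum_component_boundary o (F := T) (e := e) (w := w)
      (fun f hf hfe => hw f (by simp [hf, hfe])) (o.head e)
    rw [if_pos (self_mem_component _), if_neg (mem_component.not.mpr hne), hwb] at h1
    have hwe : w e = 0 := by simpa using h1.symm
    refine hw0 (hT.1.eq_zero_of_boundary_eq_zero o (fun f hf => ?_) hwb)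
    by_cases hfe : f = e
    · exact hfe ▸ hwe
    · exact hw f (by simp [hf, hfe])
  refine h.of_adj ?_
  rintro a b ⟨e, he⟩
  obtain ⟨e, rfl⟩ : ∃ f : E(G), (f : β) = e := ⟨⟨e, he.edge_mem⟩, rfl⟩
  rcases he.eq_and_eq_or_eq_and_eq (o.isLink e) with ⟨rfl, rfl⟩ | ⟨rfl, rfl⟩
  exacts [key e, (key e).symm]

theorem exists_isSpanningForest (o : EdgeOrientation G) : ∃ T, IsSpanningForest G T := by
  have h : IsForest (edgeSubgraph G ∅) := by
    rintro ⟨n, v, e, -, -, hl⟩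
    obtain ⟨⟨_, h⟩, -⟩ := edgeSubgraph_isLink.mp (hl 0)
    simp at h
  obtain ⟨T, -, hT⟩ := h.exists_isSpanningForest o
  exact ⟨T, hT⟩

end Chains

/-! ### Momenta of quasi-spanning forests -/

section Momentum

open Classical

variable {α β K : Type*} [Field K] {G : Graph α β}

theorem IsSpanningForest.component_erase_ne (o : EdgeOrientation G) {T : Finset E(G)}
    (hT : IsSpanningForest G T) {e : E(G)} (he : e ∈ T) :
    component G (edgeSubgraph G (T.erase e)) (o.head e) ≠
      component G (edgeSubgraph G (T.erase e)) (o.tail e) := by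
  intro h
  have h1 := self_mem_component (H := edgeSubgraph G (T.erase e)) (o.tail e)
  rw [← h] at h1
  exact hT.1.not_joined_erase he (o.isLink e) h1

theorem IsSpanningForest.component_head_eq_union (o : EdgeOrientation G) {T : Finset E(G)}
    (hT : IsSpanningForest G T) (e : E(G)) :
    component G G (o.head e) = component G (edgeSubgraph G (T.erase e)) (o.head e) ∪
      component G (edgeSubgraph G (T.erase e)) (o.tail e) := by
  ext v
  simp only [Set.mem_union, mem_component]
  constructor
  · intro h
    rcases ((hT.2 _ _).mpr h.symm).erase_or (o.isLink e) with h | h | h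
    exacts [Or.inl h.symm, Or.inl h.symm, Or.inr h.symm]
  · rintro (h | h)
    · exact h.of_edgeSubgraph
    · exact Joined.trans (Relation.ReflTransGen.single ⟨e, o.isLink e⟩) h.of_edgeSubgraph

theorem IsSpanningForest.disjoint_component_erase (o : EdgeOrientation G) {T : Finset E(G)}
    (hT : IsSpanningForest G T) {e : E(G)} (he : e ∈ T) :
    Disjoint (component G (edgeSubgraph G (T.erase e)) (o.head e))
      (component G (edgeSubgraph G (T.erase e)) (o.tail e)) := by
  rw [Set.disjoint_left]
  intro v h1 h2
  exact hT.1.not_joined_erase he (o.isLink e) (Joined.trans h1 (Joined.symm h2))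

/-- The two components of a quasi-spanning forest that do not span a component of the graph. -/
theorem IsSpanningForest.splitComponents_erase (o : EdgeOrientation G) {T : Finset E(G)}
    (hT : IsSpanningForest G T) {e : E(G)} (he : e ∈ T) :
    splitComponents G (T.erase e) = {component G (edgeSubgraph G (T.erase e)) (o.head e),
      component G (edgeSubgraph G (T.erase e)) (o.tail e)} := by
  have hne := hT.1.not_joined_erase he (o.isLink e)
  have hht : Joined G (o.head e) (o.tail e) := Relation.ReflTransGen.single ⟨e, o.isLink e⟩
  ext S
  simp only [Set.mem_insert_iff, Set.mem_singleton_iff]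
  constructor
  · rintro ⟨v, rfl, hv⟩
    by_cases h1 : Joined (edgeSubgraph G (T.erase e)) v (o.head e)
    · exact Or.inl (component_eq_of_joined h1)
    by_cases h2 : Joined (edgeSubgraph G (T.erase e)) v (o.tail e)
    · exact Or.inr (component_eq_of_joined h2)
    refine absurd (Set.ext fun w => ⟨fun h => Joined.of_edgeSubgraph h, fun h => ?_⟩) hv
    rcases ((hT.2 _ _).mpr h).erase_or (o.isLink e) with h | h | h
    exacts [h, absurd h h1, absurd h h2]
  · rintro (rfl | rfl)
    · refine ⟨_, rfl, fun h => hne ?_⟩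
      have : o.tail e ∈ component G G (o.head e) := hht
      rwa [← h] at this
    · refine ⟨_, rfl, fun h => hne ?_⟩
      have : o.head e ∈ component G G (o.tail e) := hht.symm
      rw [← h] at this
      exact Joined.symm this

variable [Fintype V(G)]

/-- The two sides of `e` partition a component of `G`, on which `p` sums to zero. Opposite sums have
equal squares, so the momentum is independent of the side. -/
theorem IsSpanningForest.momentumSum_add (o : EdgeOrientation G) {T : Finset E(G)}
    (hT : IsSpanningForest G T) {e : E(G)} (he : e ∈ T) {p : V(G) → K} (hp : IsMomentum G p) :
    momentumSum G (component G (edgeSubgraph G (T.erase e)) (o.head e)) p +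
      momentumSum G (component G (edgeSubgraph G (T.erase e)) (o.tail e)) p = 0 := by
  rw [← hp (o.head e), hT.component_head_eq_union o e]
  simp only [momentumSum, Set.mem_union]
  rw [Finset.filter_or, Finset.sum_union]
  rw [Finset.disjoint_filter]
  intro v _ h1 h2
  exact Set.disjoint_left.mp (hT.disjoint_component_erase o he) h1 h2

theorem IsSpanningForest.momentumSum_sq (o : EdgeOrientation G) {T : Finset E(G)}
    (hT : IsSpanningForest G T) {e : E(G)} (he : e ∈ T) {p : V(G) → K} (hp : IsMomentum G p)
    {S : Set V(G)} (hS : S ∈ splitComponents G (T.erase e)) :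
    momentumSum G S p ^ 2 =
      momentumSum G (component G (edgeSubgraph G (T.erase e)) (o.head e)) p ^ 2 := by
  rw [hT.splitComponents_erase o he] at hS
  rcases hS with rfl | hS
  · rfl
  · rw [Set.mem_singleton_iff.mp hS, eq_neg_of_add_eq_zero_left (hT.momentumSum_add o he hp)]
    ring

/-- Replaces the arbitrary choice in `forestMomentum` by the head side, where
`IsForest.sum_component_boundary` reads off the coefficient of a chain at `e`. -/
theorem IsSpanningForest.forestMomentum_erase (o : EdgeOrientation G) {T : Finset E(G)}
    (hT : IsSpanningForest G T) {e : E(G)} (he : e ∈ T) {p : V(G) → K} (hp : IsMomentum G p) :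
    forestMomentum G (T.erase e) p =
      momentumSum G (component G (edgeSubgraph G (T.erase e)) (o.head e)) p ^ 2 := by
  have h : (splitComponents G (T.erase e)).Nonempty := by
    rw [hT.splitComponents_erase o he]
    exact Set.insert_nonempty _ _
  rw [forestMomentum, dif_pos h]
  exact hT.momentumSum_sq o he hp h.some_mem

/-- The momentum of a quasi-spanning forest is well defined. -/
theorem IsQuasiSpanningForest.momentum_wellDefined (o : EdgeOrientation G) {F : Finset E(G)}
    (hF : IsQuasiSpanningForest G F) {p : V(G) → K} (hp : IsMomentum G p) :
    (splitComponents G F).ncard = 2 ∧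
      ∀ S ∈ splitComponents G F, momentumSum G S p ^ 2 = forestMomentum G F p := by
  obtain ⟨T, hT, e, he, rfl⟩ := hF
  refine ⟨?_, fun S hS => ?_⟩
  · rw [hT.splitComponents_erase o he, Set.ncard_pair (hT.component_erase_ne o he)]
  · rw [hT.momentumSum_sq o he hp hS, hT.forestMomentum_erase o he hp]

/-- Every momentum is a boundary. -/
theorem IsMomentum.exists_boundary_eq [Fintype E(G)] (o : EdgeOrientation G) {p : V(G) → K}
    (hp : IsMomentum G p) : ∃ q : E(G) → K, boundary o K q = p := by
  obtain ⟨T, hT⟩ := exists_isSpanningForest o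
  let s : Setoid V(G) :=
    ⟨fun x y => Joined G x y, fun _ => Relation.ReflTransGen.refl, Joined.symm, Joined.trans⟩
  -- `r` picks a root in each component of `G`. A path in `T` from `r v` to `v`, weighted by `p v`,
  -- has boundary `p v • (v - r v)`; the root terms cancel because `p` sums to zero on each
  -- component.
  let r : V(G) → V(G) := fun v => (Quotient.mk s v).out
  have hr : ∀ v, Joined G (r v) v := fun v => Quotient.mk_out (s := s) v
  have hr' : ∀ v w : V(G), Joined G v w → r v = r w := fun v w h =>
    congrArg Quotient.out (Quotient.sound (s := s) h)
  choose w _ hwb using fun v => Joined.exists_chain o K ((hT.2 _ _).mpr (hr v))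
  refine ⟨∑ v, p v • w v, ?_⟩
  have hzero : ∑ v, p v • (Pi.single (r v) 1 : V(G) → K) = 0 := by
    ext u
    simp only [Finset.sum_apply, Pi.smul_apply, smul_eq_mul, Pi.single_apply, mul_ite, mul_one,
      mul_zero, Pi.zero_apply]
    rw [← Finset.sum_filter]
    by_cases hu : r u = u
    · rw [← hp u, momentumSum]
      refine Finset.sum_congr (Finset.filter_congr fun v _ => ?_) fun _ _ => rfl
      rw [mem_component]
      constructor
      · intro h
        rw [h]
        exact hr v
      · intro h
        rw [← hr' u v h, hu]
    · rw [Finset.filter_false_of_mem, Finset.sum_empty]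
      intro v _ h
      apply hu
      rw [h]
      exact hr' _ _ (hr v)
  rw [map_sum]
  simp only [map_smul, hwb, smul_sub, Finset.sum_sub_distrib]
  rw [hzero, sub_zero]
  ext u
  simp [Pi.single_apply]

end Momentum

/-! ### Integral and relative homology, and the minors -/

section Homology

open Classical Matrix

variable {α β K : Type*} [Field K] {G : Graph α β} [Fintype E(G)] (o : EdgeOrientation G)

theorem boundary_intCast {w : E(G) → ℤ} (hw : boundary o ℤ w = 0) :
    boundary o K (fun e => (w e : K)) = 0 := by
  ext v
  have h := congrArg (Int.cast : ℤ → K) (congrFun hw v)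
  rw [boundary_apply] at h ⊢
  simp only [Finset.sum_apply, Pi.smul_apply, Pi.sub_apply, smul_eq_mul, Pi.single_apply] at h ⊢
  push_cast at h
  simpa using h

theorem mem_relativeHomology {p : V(G) → K} {w : E(G) → K} :
    w ∈ relativeHomology o p ↔ ∃ a : K, a • p = boundary o K w := by
  rw [relativeHomology, Submodule.mem_comap, Submodule.mem_span_singleton]

theorem isCutSet_compl_iff {F : Finset E(G)} : IsCutSet G Fᶜ ↔ IsQuasiSpanningForest G F := by
  constructor
  · rintro ⟨F', hF', h⟩
    rwa [compl_injective h]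
  · exact fun h => ⟨F, h, rfl⟩

variable [Fintype V(G)]

/-- For a spanning forest `T`, the projection of the integral homology to the coordinates outside
of `T` is an isomorphism. -/
noncomputable def IsSpanningForest.homologyEquiv {T : Finset E(G)} (hT : IsSpanningForest G T) :
    integralHomology o ≃ₗ[ℤ] ({e // e ∉ T} → ℤ) :=
  LinearEquiv.ofBijective
    ((LinearMap.funLeft ℤ ℤ (Subtype.val : {e // e ∉ T} → E(G))).comp
      (integralHomology o).subtype) <| by
    constructor
    -- Injectivity: a cycle vanishing off `T` is carried by a forest.
    · rw [← LinearMap.ker_eq_bot, LinearMap.ker_eq_bot']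
      rintro ⟨w, hw⟩ h
      refine Subtype.ext (hT.1.eq_zero_of_boundary_eq_zero o (fun f hf => ?_) hw)
      exact congrFun h ⟨f, hf⟩
    -- Surjectivity: extend `c` by zero and subtract a chain carried by `T` with the same boundary.
    · intro c
      let w : E(G) → ℤ := fun e => if h : e ∉ T then c ⟨e, h⟩ else 0
      obtain ⟨u, hu, hub⟩ := hT.exists_chain o w
      refine ⟨⟨w - u, ?_⟩, ?_⟩
      · rw [integralHomology, LinearMap.mem_ker, map_sub, hub, sub_self]
      · ext ⟨e, he⟩
        simp [LinearMap.funLeft_apply, w, he, hu e he]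

/-- For a basis of the integral homology, the minor with columns the complement of a spanning
forest is invertible. -/
theorem IsSpanningForest.exists_equiv_isUnit_det {T : Finset E(G)} (hT : IsSpanningForest G T)
    {n : ℕ} (ℓ : Module.Basis (Fin n) ℤ (integralHomology o)) :
    ∃ τ : Fin n ≃ {e // e ∉ T},
      IsUnit (Matrix.of fun i j => (ℓ i : E(G) → ℤ) (τ j) : Matrix (Fin n) (Fin n) ℤ).det := by
  let b := ℓ.map (hT.homologyEquiv o)
  -- Transported by the isomorphism, `ℓ` becomes a second basis of `ℤ^(E \ T)`; the minor is a
  -- change-of-basis determinant over `ℤ`.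
  let τ := b.indexEquiv (Pi.basisFun ℤ {e // e ∉ T})
  refine ⟨τ, ?_⟩
  have h := (Pi.basisFun ℤ {e // e ∉ T}).isUnit_det (b.reindex τ)
  rw [Module.Basis.det_apply, ← det_transpose] at h
  rw [← det_submatrix_equiv_self τ] at h
  have hM : (Matrix.of fun i j => (ℓ i : E(G) → ℤ) (τ j) : Matrix (Fin n) (Fin n) ℤ) =
      ((Pi.basisFun ℤ {e // e ∉ T}).toMatrix (b.reindex τ))ᵀ.submatrix τ τ := by
    ext i j
    simp only [Matrix.of_apply, submatrix_apply, transpose_apply, Module.Basis.toMatrix_apply,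
      Module.Basis.reindex_apply, Equiv.symm_apply_apply, Pi.basisFun_repr, b,
      Module.Basis.map_apply]
    rfl
  rw [hM]
  exact h

theorem IsSpanningForest.card_compl {T : Finset E(G)} (hT : IsSpanningForest G T)
    {n : ℕ} (ℓ : Module.Basis (Fin n) ℤ (integralHomology o)) : Tᶜ.card = n := by
  obtain ⟨τ, -⟩ := hT.exists_equiv_isUnit_det o ℓ
  have h := Fintype.card_congr τ
  rw [Fintype.card_fin, Fintype.card_subtype_compl, Fintype.card_coe] at h
  rw [Finset.card_compl, h]

/-- A lift of `p` and a basis of the integral homology form a basis of the homology relative to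
`p`. -/
theorem exists_basis_relativeHomology {p : V(G) → K} (hp0 : p ≠ 0) {n : ℕ}
    (ℓ : Module.Basis (Fin n) ℤ (integralHomology o)) {q : E(G) → K} (hq : boundary o K q = p) :
    ∃ b : Module.Basis (Fin (n + 1)) K (relativeHomology o p), (b 0 : E(G) → K) = q ∧
      ∀ (i : Fin n) (e : E(G)), (b i.succ : E(G) → K) e = (((ℓ i : E(G) → ℤ) e : ℤ) : K) := by
  obtain ⟨T, hT⟩ := exists_isSpanningForest o
  obtain ⟨τ, hτ⟩ := hT.exists_equiv_isUnit_det o ℓ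
  let L : Fin n → E(G) → K := fun i e => (((ℓ i : E(G) → ℤ) e : ℤ) : K)
  have hL : ∀ i, boundary o K (L i) = 0 := fun i => boundary_intCast o (ℓ i).2
  let N : Matrix (Fin n) (Fin n) K := Matrix.of fun i j => L i (τ j)
  -- A unit of `ℤ` stays a unit in `K`, so independence survives in every characteristic.
  have hN : IsUnit N := by
    rw [Matrix.isUnit_iff_isUnit_det]
    have h := hτ.map (Int.castRingHom K)
    rw [RingHom.map_det] at h
    exact h
  let u : Fin (n + 1) → relativeHomology o p :=
    Fin.cons ⟨q, (mem_relativeHomology o).mpr ⟨1, by rw [one_smul, hq]⟩⟩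
      fun i => ⟨L i, (mem_relativeHomology o).mpr ⟨0, by rw [zero_smul, hL]⟩⟩
  have hsum : ∀ c : Fin (n + 1) → K,
      ((∑ i, c i • u i : relativeHomology o p) : E(G) → K) = c 0 • q + ∑ i, c i.succ • L i := by
    intro c
    simp [Fin.sum_univ_succ, u]
  have hli : LinearIndependent K u := by
    rw [Fintype.linearIndependent_iff]
    intro c hc
    have h := congrArg Subtype.val hc
    rw [hsum] at h
    -- The boundary kills every `L i`, leaving `c 0 • p = 0`.
    have h0 : c 0 = 0 := by
      have hb := congrArg (boundary o K) h
      simp only [map_add, map_sum, map_smul, hL, hq, smul_zero, Finset.sum_const_zero, add_zero,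
        ZeroMemClass.coe_zero, map_zero, smul_eq_zero] at hb
      exact hb.resolve_right hp0
    have hN0 : (fun i : Fin n => c i.succ) ᵥ* N = 0 := by
      ext j
      have hj := congrFun h (τ j)
      simpa [h0, vecMul, dotProduct, N] using hj
    have hc0 : (fun i : Fin n => c i.succ) = 0 :=
      Matrix.vecMul_injective_of_isUnit hN (hN0.trans (zero_vecMul N).symm)
    intro i
    exact Fin.cases h0 (fun i => congrFun hc0 i) i
  have hspan : ⊤ ≤ Submodule.span K (Set.range u) := by
    rintro ⟨x, hx⟩ -
    obtain ⟨a, ha⟩ := (mem_relativeHomology o).mp hx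
    -- Choose `c` to make `x - a • q - ∑ c i • L i` vanish off `T`; being a cycle, it is then zero.
    obtain ⟨c, hc⟩ := (Matrix.vecMul_surjective_iff_isUnit.mpr hN) fun j => (x - a • q) (τ j)
    have hz : x - a • q - ∑ i, c i • L i = 0 := by
      refine hT.1.eq_zero_of_boundary_eq_zero o (fun f hf => ?_) ?_
      · have h := congrFun hc (τ.symm ⟨f, hf⟩)
        simp only [vecMul, dotProduct, N, Matrix.of_apply, Equiv.apply_symm_apply] at h
        simp only [Pi.sub_apply, Finset.sum_apply, Pi.smul_apply, smul_eq_mul] at h ⊢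
        rw [h, sub_self]
      · simp [hL, hq, ha]
    rw [Submodule.mem_span_range_iff_exists_fun]
    refine ⟨Fin.cons a c, Subtype.ext ?_⟩
    rw [hsum]
    simp only [Fin.cons_zero, Fin.cons_succ]
    rw [sub_sub, sub_eq_zero] at hz
    exact hz.symm
  refine ⟨Module.Basis.mk hli hspan, ?_, fun i e => ?_⟩
  · simp [u]
  · simp [u, L]

variable {o} in
/-- The square of the Plücker coordinate at a cut set is the momentum of the cut set. -/
theorem plucker_sq_of_isCutSet {p : V(G) → K} (hp : IsMomentum G p) (hp0 : p ≠ 0) {n : ℕ}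
    (ℓ : Module.Basis (Fin n) ℤ (integralHomology o)) {q : E(G) → K} (hq : boundary o K q = p)
    (b : Module.Basis (Fin (n + 1)) K (relativeHomology o p)) (hb0 : (b 0 : E(G) → K) = q)
    (hb : ∀ (i : Fin n) (e : E(G)), (b i.succ : E(G) → K) e = (((ℓ i : E(G) → ℤ) e : ℤ) : K))
    {C : Finset E(G)} (hC : IsCutSet G C) (σ : Fin (n + 1) ≃ C) :
    plucker b σ ^ 2 = cutMomentum G C p := by
  obtain ⟨F, ⟨T, hT, e, he, rfl⟩, rfl⟩ := hC
  obtain ⟨τ, hτ⟩ := hT.exists_equiv_isUnit_det o ℓ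
  -- List the cut set with `e` first, then the complement of `T` in the order `τ`; the Plücker
  -- square ignores the listing.
  let f : Fin (n + 1) → ↥(T.erase e)ᶜ :=
    Fin.cons ⟨e, by simp⟩ fun j => ⟨τ j, by
      rw [Finset.mem_compl]
      exact fun h => (τ j).2 (Finset.mem_of_mem_erase h)⟩
  have hf : Function.Bijective f := by
    constructor
    · rw [Fin.cons_injective_iff]
      constructor
      · rintro ⟨j, hj⟩
        have hj' : ((τ j : {e // e ∉ T}) : E(G)) = e :=
          congrArg (fun x : ↥(T.erase e)ᶜ => (x : E(G))) hj
        exact (τ j).2 (hj' ▸ he)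
      · intro i j hij
        have h : ((τ i : {e // e ∉ T}) : E(G)) = τ j :=
          congrArg (fun x : ↥(T.erase e)ᶜ => (x : E(G))) hij
        exact τ.injective (Subtype.ext h)
    · rintro ⟨g, hg⟩
      by_cases hge : g = e
      · exact ⟨0, Subtype.ext hge.symm⟩
      · have hgT : g ∉ T := fun h => Finset.mem_compl.mp hg (Finset.mem_erase.mpr ⟨hge, h⟩)
        exact ⟨(τ.symm ⟨g, hgT⟩).succ, Subtype.ext (by simp [f])⟩
  rw [plucker_sq_eq b σ (Equiv.ofBijective f hf)]
  obtain ⟨q', hq', hqb⟩ := hT.exists_chain o q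
  rw [hq] at hqb
  have hmem : q' ∈ relativeHomology o p := (mem_relativeHomology o).mpr ⟨1, by rw [one_smul, hqb]⟩
  let c : Fin (n + 1) → K := fun i => b.repr ⟨q', hmem⟩ i
  have hsum : ∑ i, c i • (b i : E(G) → K) = q' := by
    have h := congrArg Subtype.val (b.sum_repr ⟨q', hmem⟩)
    simpa only [Submodule.coe_sum, Submodule.coe_smul] using h
  -- Comparing boundaries gives `q` coefficient one in `q'`, so replacing the row of `q` by `q'`
  -- preserves the determinant.
  have hc0 : c 0 = 1 := by
    have h := congrArg (boundary o K) hsum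
    have hbs : ∀ i : Fin n, boundary o K (b i.succ) = 0 := by
      intro i
      have : (b i.succ : E(G) → K) = fun e => (((ℓ i : E(G) → ℤ) e : ℤ) : K) := funext (hb i)
      rw [this]
      exact boundary_intCast o (ℓ i).2
    simp only [map_add, map_sum, map_smul, Fin.sum_univ_succ, hbs, hb0, hq, hqb, smul_zero,
      Finset.sum_const_zero, add_zero] at h
    have h' : (c 0 - 1) • p = 0 := by rw [sub_smul, h, one_smul, sub_self]
    exact sub_eq_zero.mp ((smul_eq_zero.mp h').resolve_right hp0)
  let A : Matrix (Fin (n + 1)) (Fin (n + 1)) K :=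
    Matrix.of fun i j => (b i : E(G) → K) (f j : E(G))
  have hA : plucker b (Equiv.ofBijective f hf) = A.det := rfl
  have hA' : (A.updateRow 0 fun j => q' (f j)).det = A.det := by
    have h := Matrix.det_updateRow_sum A 0 c
    rw [hc0, one_smul] at h
    rw [← h]
    congr 2
    ext j
    rw [← hsum]
    simp [A]
  have hdet : (A.updateRow 0 fun j => q' (f j)).det =
      q' e * (Matrix.of fun i j => (((ℓ i : E(G) → ℤ) (τ j) : ℤ) : K) :
        Matrix (Fin n) (Fin n) K).det := by
    -- Only the entry at `e` survives in the first row, as `q'` vanishes off `T`.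
    rw [Matrix.det_succ_row_zero, Fin.sum_univ_succ]
    rw [Finset.sum_eq_zero, add_zero]
    · simp only [Fin.val_zero, pow_zero, one_mul, Matrix.updateRow_self]
      congr 2
      ext i j
      simp [A, f, hb, Matrix.updateRow_apply]
    · intro j _
      have : q' (f j.succ) = 0 := hq' _ (τ j).2
      simp [this]
  have hunit : (Matrix.of fun i j => (((ℓ i : E(G) → ℤ) (τ j) : ℤ) : K) :
        Matrix (Fin n) (Fin n) K).det ^ 2 = 1 := by
    have h := congrArg (Int.castRingHom K) (Int.isUnit_sq hτ)
    rw [map_pow, RingHom.map_det, map_one] at h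
    exact h
  rw [hA, ← hA', hdet, mul_pow, hunit, mul_one, cutMomentum, compl_compl,
    hT.forestMomentum_erase o he hp, ← hT.1.sum_component_boundary o he hq', hqb, momentumSum]

theorem IsCutSet.card_eq {C : Finset E(G)} (hC : IsCutSet G C) {n : ℕ}
    (ℓ : Module.Basis (Fin n) ℤ (integralHomology o)) : C.card = n + 1 := by
  obtain ⟨F, ⟨T, hT, e, he, rfl⟩, rfl⟩ := hC
  rw [Finset.compl_erase, Finset.card_insert_of_notMem (by simpa using he), hT.card_compl o ℓ]

variable {o} in
/-- The Plücker coordinates vanish outside of the cut sets. -/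
theorem plucker_eq_zero_of_not_isCutSet {p : V(G) → K} {n : ℕ}
    (ℓ : Module.Basis (Fin n) ℤ (integralHomology o))
    (b : Module.Basis (Fin (n + 1)) K (relativeHomology o p))
    {C : Finset E(G)} (hC : ¬ IsCutSet G C) (σ : Fin (n + 1) ≃ C) : plucker b σ = 0 := by
  by_cases hF : IsForest (edgeSubgraph G Cᶜ)
  · exfalso
    obtain ⟨T, hFT, hT⟩ := hF.exists_isSpanningForest o
    -- `T` has `|E| - n` edges and `Cᶜ` has `|E| - (n + 1)`.
    have hcard : (T \ Cᶜ).card = 1 := by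
      have h1 := hT.card_compl o ℓ
      have h2 := Fintype.card_congr σ
      rw [Fintype.card_fin, Fintype.card_coe] at h2
      have h3 := Finset.card_sdiff_add_card_eq_card hFT
      have h4 := Finset.card_add_card_compl T
      have h5 := Finset.card_add_card_compl C
      omega
    obtain ⟨e, he⟩ := Finset.card_eq_one.mp hcard
    have heT : e ∈ T \ Cᶜ := he ▸ Finset.mem_singleton_self e
    refine hC ⟨Cᶜ, ⟨T, hT, e, (Finset.mem_sdiff.mp heT).1, ?_⟩, (compl_compl C).symm⟩
    rw [← Finset.sdiff_singleton_eq_erase, ← he, Finset.sdiff_sdiff_eq_self hFT]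
  · obtain ⟨w, hw0, hw, hwb⟩ := exists_cycle_of_not_isForest o (R := K) hF
    refine plucker_eq_zero b σ ((mem_relativeHomology o).mpr ⟨0, by rw [zero_smul, hwb]⟩) hw0 ?_
    exact fun e he => hw e (by simpa using he)

/-- The second graph polynomial as a sum over all sets of edges. -/
theorem secondGraphPoly_eq_sum (p : V(G) → K) :
    secondGraphPoly G p = ∑ C : Finset E(G),
      MvPolynomial.C (if IsCutSet G C then cutMomentum G C p else 0) *
        ∏ e ∈ C, (MvPolynomial.X e : MvPolynomial E(G) K) := by
  rw [secondGraphPoly, Finset.sum_filter]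
  refine Fintype.sum_equiv (Function.Involutive.toPerm _ compl_involutive) _ _ fun F => ?_
  simp only [Function.Involutive.coe_toPerm, isCutSet_compl_iff, cutMomentum, compl_compl]
  split_ifs <;> simp

variable {o} in
theorem configDet_eq_secondGraphPoly {p : V(G) → K} (hp : IsMomentum G p) (hp0 : p ≠ 0) {n : ℕ}
    (ℓ : Module.Basis (Fin n) ℤ (integralHomology o)) {q : E(G) → K} (hq : boundary o K q = p)
    (b : Module.Basis (Fin (n + 1)) K (relativeHomology o p)) (hb0 : (b 0 : E(G) → K) = q)
    (hb : ∀ (i : Fin n) (e : E(G)), (b i.succ : E(G) → K) e = (((ℓ i : E(G) → ℤ) e : ℤ) : K)) :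
    configDet b = secondGraphPoly G p := by
  rw [secondGraphPoly_eq_sum]
  refine configDet_eq_sum b _ (fun C σ => ?_) fun C hC => ?_
  · split_ifs with h
    · exact plucker_sq_of_isCutSet hp hp0 ℓ hq b hb0 hb h σ
    · rw [plucker_eq_zero_of_not_isCutSet ℓ b h σ]
      ring
  -- A set of the wrong size has no listing; it cannot be a cut set, since those have `n + 1`
  -- elements.
  · refine if_neg fun h => hC.false (Fintype.equivOfCardEq ?_)
    rw [Fintype.card_fin, Fintype.card_coe, h.card_eq o ℓ]

end Homology

end GraphPoly

theorem propositionP {α β K : Type*} [Field K] (G : Graph α β) [Fintype V(G)] [Fintype E(G)]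
    (o : EdgeOrientation G) (p : V(G) → K) (hp : IsMomentum G p) (hp0 : p ≠ 0) :
    -- the momentum of a quasi-spanning forest is well defined
    (∀ F : Finset E(G), IsQuasiSpanningForest G F → (splitComponents G F).ncard = 2 ∧
      ∀ T ∈ splitComponents G F, momentumSum G T p ^ 2 = forestMomentum G F p) ∧
    IsConfigPolynomial (relativeHomology o p) (secondGraphPoly G p) ∧
    -- integral bases of the homology and lifts of `p` exist
    (∃ n : ℕ, Nonempty (Module.Basis (Fin n) ℤ (integralHomology o))) ∧
    (∃ q : E(G) → K, boundary o K q = p) ∧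
    ∀ (n : ℕ) (ℓ : Module.Basis (Fin n) ℤ (integralHomology o)) (q : E(G) → K),
      boundary o K q = p →
      ∃ b : Module.Basis (Fin (n + 1)) K (relativeHomology o p),
        (b 0 : E(G) → K) = q ∧
        (∀ (i : Fin n) (e : E(G)), (b i.succ : E(G) → K) e = (((ℓ i : E(G) → ℤ) e : ℤ) : K)) ∧
        configDet b = secondGraphPoly G p ∧
        (∀ C : Finset E(G), IsCutSet G C → C.card = n + 1 ∧
          ∀ σ : Fin (n + 1) ≃ C, plucker b σ ^ 2 = cutMomentum G C p) ∧
        (∀ C : Finset E(G), ¬ IsCutSet G C → ∀ σ : Fin (n + 1) ≃ C, plucker b σ = 0) := by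
  obtain ⟨q₀, hq₀⟩ := hp.exists_boundary_eq o
  let ℓ₀ := Module.finBasis ℤ (integralHomology o)
  refine ⟨fun F hF => hF.momentum_wellDefined o hp, ?_, ⟨_, ⟨ℓ₀⟩⟩, ⟨q₀, hq₀⟩, ?_⟩
  · obtain ⟨b, hb0, hb⟩ := exists_basis_relativeHomology o hp0 ℓ₀ hq₀
    rw [← configDet_eq_secondGraphPoly hp hp0 ℓ₀ hq₀ b hb0 hb]
    refine isConfigPolynomial_configDet b fun h => b.ne_zero 0 ?_
    exact Subtype.ext ((Submodule.mem_bot K).mp (h ▸ (b 0).2))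
  · intro n ℓ q hq
    obtain ⟨b, hb0, hb⟩ := exists_basis_relativeHomology o hp0 ℓ hq
    exact ⟨b, hb0, hb, configDet_eq_secondGraphPoly hp hp0 ℓ hq b hb0 hb,
      fun C hC => ⟨hC.card_eq o ℓ, plucker_sq_of_isCutSet hp hp0 ℓ hq b hb0 hb hC⟩,
      fun C hC => plucker_eq_zero_of_not_isCutSet ℓ b hC⟩
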